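/- **Setting.** Let $\mathcal P$ be a finite set of labelled prototiles: compact sets $\operatorname{supp}(p)\subset\mathbb R^2$ equal to the closure of their interior, each with the origin in its interior; the puncture of the tile $p+x$ is the point $x$. Let $\omega$ be a primitive substitution rule on $\mathcal P$ with scaling factor $\lambda>1$: $\omega(p)$ is a finite set of translated prototiles with pairwise disjoint interiors whose union is $\lambda\operatorname{supp}(p)$ and has connected interior. Put $\omega(p+x)=\omega(p)+\lambda x$, assume $p\in\omega(p)$ for all $p\in\mathcal P$, and let $T_p=\bigcup_n\omega^n(p)$. Suppose that the boundaries of the prototiles are divided into finitely many arcs (edges) so that the tiles of each $T_p$ meet singly edge-to-edge. A *quasi-dual tree* $G_p$ in $p$ is a finite tree embedded in $\operatorname{supp}(p)$, with arcs as edges and with the puncture $0$ as one of its interior vertices, that meets $\partial \operatorname{supp}(p)$ only in its boundary vertices, of which there is exactly one in the relative interior of each edge of $p$. (A *dual tree* is the case of a single interior vertex, joined by an edge to each boundary vertex.) A family $G=(G_p)_{p\in\mathcal P}$ is *consistent* if boundary vertices coincide wherever edges of two tiles of some $T_q$ coincide. For a family $B=(B_p)_p$ of subsets of the plane let $\mathcal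 R(B)_p=\bigcup_{q+x\in\omega^N(p)}\lambda^{-N}(B_q+x)$, where $N\ge1$ is fixed. Let $(G,S)$ be a *recurrent pair* of consistent quasi-dual trees: $S\subset\mathcal R(G)$, and there is a homeomorphism $\psi:G\to S$ that maps vertices to vertices and edges to edges, preserves the puncture of each prototile, and preserves the edge of the prototile on which a boundary vertex lies. For $e\in E(G_p)$ and $f\in E(G_q)$ let $$D^E_{ef}=\{x: q+x\in\omega^N(p),\ \lambda^{-N}(f+x)\subset\psi(e)\},\qquad M^E_{ef}=|D^E_{ef}|,$$ and suppose that $M^E$ is primitive, with Perron–Frobenius eigenvalue $\kappa$ and a positive eigenvector $v$, $M^Ev=\kappa v$. Suppose that the attractor of the associated graph iterated function system, $A_e=\bigcup_f\bigcup_{x\in D^E_{ef}}\lambda^{-N}(A_f+x)$ ($e\in E(G)$), forms a consistent family of quasi-dual trees $A$ (the *fractal graph*) with the same combinatorial structure as $G$. Give each translate of $A_e$ the length $v_e$. Let $F_1\subset\mathcal R(A)$ be a graph such that, for each $p$, $(F_1)_p$ is a connected tree in the interior of $\operatorname{supp}(p)$ that has $\lambda^{-N}x(t)$ as a vertex for each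 tile $t\in\omega^N(p)$, where $x(t)$ is the puncture of $t$, and that contains all those edges of $\mathcal R(A)_p$ contained in $A_p$ of which no end point is a boundary vertex of $A_p$. Put $F_{n+1}=\mathcal R(F_n)\cup F_n$, where each edge of $F_n$ is subdivided into the edges of $\mathcal R^{n+1}(A)$ of which it consists, and let $\mathfrak F_p=\bigcup_{n\ge1}\lambda^{Nn}(F_n)_p$, the *fractal tree* on $T_p$, whose edges are translates of edges of $A$. The *fractal distance* $d_{\mathfrak F_p}(t,t')$ of $t,t'\in T_p$ is the sum of the lengths of the edges of the path in $\mathfrak F_p$ from the puncture of $t$ to that of $t'$ (the infimum over such paths, should there be several). For $p\in\mathcal P$ let $D_p$ be the self-adjoint operator on $\ell^2(T_p\setminus\{p\})$ with $D_p\delta_t=\ln\bigl(d_{\mathfrak F_p}(t,p)\bigr)\,\delta_t$, with domain $\{\xi:\sum_t|\ln(d_{\mathfrak F_p}(t,p))\,\xi(t)|^2<\infty\}$. **Proposition.** For every $p\in\mathcal P$ and every $\alpha>0$, the operator $\exp(-\alpha D_p^2)$, defined by the functional calculus of $D_p$, is trace class on $\ell^2(T_p\setminus\{p\})$. -/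

import Mathlib

noncomputable section

namespace FractalTiling

/-- The Euclidean plane. -/
abbrev Plane := EuclideanSpace ℝ (Fin 2)

/-- The translate `X + x` of a subset of the plane. -/
def translate (X : Set Plane) (x : Plane) : Set Plane := (fun y => y + x) '' X

/-- The scaled copy `c X` of a subset of the plane. -/
def dilate (c : ℝ) (X : Set Plane) : Set Plane := (fun y => c • y) '' X

/-! ### Prototiles, tiles, substitution rules -/

/-- A family of prototiles with labels in `P`: compact subsets of the plane, equal to the closure
of their interior, with the puncture of every prototile placed at the origin, in its interior. -/
structure PrototileSet (P : Type*) where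
  supp : P → Set Plane
  isCompact_supp : ∀ p, IsCompact (supp p)
  closure_interior_supp : ∀ p, closure (interior (supp p)) = supp p
  zero_mem_interior : ∀ p, (0 : Plane) ∈ interior (supp p)

/-- The pair `(p, x)` is the tile `p + x`, a labelled set; its puncture is the point `x`. -/
abbrev Tile (P : Type*) := P × Plane

/-- The support of the tile `p + x`. -/
def PrototileSet.tileSupp {P : Type*} (𝒬 : PrototileSet P) (t : Tile P) : Set Plane :=
  translate (𝒬.supp t.1) t.2

/-- A substitution rule `ω` with scaling factor `λ = scale > 1`: for each prototile `p`, `ω(p)` is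
a patch (a finite set of tiles whose union has connected interior) that covers `λ supp(p)` by tiles
with pairwise disjoint interiors. -/
structure Substitution {P : Type*} (𝒬 : PrototileSet P) where
  scale : ℝ
  one_lt_scale : 1 < scale
  rule : P → Finset (Tile P)
  isConnected_interior : ∀ p, IsConnected (interior (⋃ t ∈ rule p, 𝒬.tileSupp t))
  cover : ∀ p, (⋃ t ∈ rule p, 𝒬.tileSupp t) = dilate scale (𝒬.supp p)
  disjoint_interior : ∀ p, ∀ t ∈ rule p, ∀ t' ∈ rule p, t ≠ t' →
    Disjoint (interior (𝒬.tileSupp t)) (interior (𝒬.tileSupp t'))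

namespace Substitution

variable {P : Type*} {𝒬 : PrototileSet P} (ω : Substitution 𝒬)

/-- The substitution extended to sets of tiles, by `ω(p + x) = ω(p) + λ x`. -/
def apply (X : Set (Tile P)) : Set (Tile P) :=
  {s | ∃ t ∈ X, ∃ u ∈ ω.rule t.1, s = (u.1, u.2 + ω.scale • t.2)}

/-- The supertile `ωⁿ(p)`. -/
def supertile (n : ℕ) (p : P) : Set (Tile P) := ω.apply^[n] {(p, 0)}

/-- The tiling `T_p = ⋃ₙ ωⁿ(p)` generated by `p`. -/
def tiling (p : P) : Set (Tile P) := ⋃ n, ω.supertile n p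

/-- The substitution matrix: `M p q` is the number of translates of `q` in `ω(p)`. -/
def matrix : Matrix P P ℝ :=
  Matrix.of fun p q => (Set.ncard {x : Plane | (q, x) ∈ ω.rule p} : ℝ)

/-- A primitive substitution rule. -/
def IsPrimitive [Fintype P] [DecidableEq P] : Prop := ω.matrix.IsPrimitive

/-- Every prototile is one of the tiles of its substitution: `p ∈ ω(p)`. -/
def FixesPrototiles : Prop := ∀ p, (p, (0 : Plane)) ∈ ω.rule p

end Substitution

/-! ### Edges of prototiles -/

/-- `X` is an arc with end points `a` and `b`: the image of `[0,1]` under an injective continuous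
map that sends `0` to `a` and `1` to `b`. -/
def IsArc (X : Set Plane) (a b : Plane) : Prop :=
  ∃ f : C(unitInterval, Plane), Function.Injective f ∧ Set.range f = X ∧ f 0 = a ∧ f 1 = b

/-- The decomposition of the boundaries of the prototiles into edges, here called sides; they are
indexed by a type `σ`, and `owner s` is the prototile of which `s` is a side. A side is an arc; its
end points are vertices of the prototile. -/
structure SideStructure {P : Type*} (𝒬 : PrototileSet P) (σ : Type*) where
  owner : σ → P
  carrier : σ → Set Plane
  fst : σ → Plane
  snd : σ → Plane
  isArc : ∀ s, IsArc (carrier s) (fst s) (snd s)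
  union_eq : ∀ p, (⋃ s ∈ {s | owner s = p}, carrier s) = frontier (𝒬.supp p)
  inter_subset : ∀ s s', s ≠ s' → owner s = owner s' →
    carrier s ∩ carrier s' ⊆ {fst s, snd s} ∩ {fst s', snd s'}

namespace SideStructure

variable {P σ : Type*} {𝒬 : PrototileSet P} (B : SideStructure 𝒬 σ)

/-- `X` is an edge of the tile `t`. -/
def IsTileSide (t : Tile P) (s : σ) (X : Set Plane) : Prop :=
  B.owner s = t.1 ∧ X = translate (B.carrier s) t.2

/-- `z` is a vertex of the tile `t`. -/
def IsTileVertex (t : Tile P) (z : Plane) : Prop :=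
  ∃ s, B.owner s = t.1 ∧ (z = B.fst s + t.2 ∨ z = B.snd s + t.2)

/-- The tiles of `T` meet singly edge-to-edge: two distinct tiles meet only along common full edges
and at common vertices, and they have at most one common edge. -/
def IsSinglyEdgeToEdge (T : Set (Tile P)) : Prop :=
  ∀ t ∈ T, ∀ t' ∈ T, t ≠ t' →
    (∀ z ∈ 𝒬.tileSupp t ∩ 𝒬.tileSupp t',
      (∃ s s' X, B.IsTileSide t s X ∧ B.IsTileSide t' s' X ∧ z ∈ X) ∨
        (B.IsTileVertex t z ∧ B.IsTileVertex t' z)) ∧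
    (∀ X Y s₁ s₁' s₂ s₂', B.IsTileSide t s₁ X → B.IsTileSide t' s₁' X →
      B.IsTileSide t s₂ Y → B.IsTileSide t' s₂' Y → X = Y)

end SideStructure

/-! ### Dual trees and recurrent pairs -/

/-- The combinatorial type of a family `G = ⊔ G_p` of (quasi-)dual trees, one for each prototile.
The vertices are `σ ⊕ I`: one boundary vertex for each side of a prototile, and the interior
vertices `I`. The edges are indexed by `E`, and `src`, `tgt` are the end points of an edge. The
vertices and edges that belong to a prototile `p` form a tree, and one of its interior vertices,
`puncture p`, is singled out. -/
structure TreeShape {P σ : Type*} {𝒬 : PrototileSet P} (B : SideStructure 𝒬 σ)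
    (I E : Type*) where
  intOwner : I → P
  owner : E → P
  src : E → σ ⊕ I
  tgt : E → σ ⊕ I
  puncture : P → I
  owner_src : ∀ e, Sum.elim B.owner intOwner (src e) = owner e
  owner_tgt : ∀ e, Sum.elim B.owner intOwner (tgt e) = owner e
  intOwner_puncture : ∀ p, intOwner (puncture p) = p
  isTree : ∀ p, (SimpleGraph.fromRel
    (fun u v : {w : σ ⊕ I // Sum.elim B.owner intOwner w = p} =>
      ∃ e, src e = u ∧ tgt e = v)).IsTree
  edge_unique : ∀ e f, s(src e, tgt e) = s(src f, tgt f) → e = f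

/-- The prototile to which a vertex belongs. -/
def TreeShape.vertexOwner {P σ I E : Type*} {𝒬 : PrototileSet P} {B : SideStructure 𝒬 σ}
    (Γ : TreeShape B I E) : σ ⊕ I → P :=
  Sum.elim B.owner Γ.intOwner

/-- A family of (quasi-)dual trees of combinatorial type `Γ`: geometric graphs embedded in the
prototiles. The edges are arcs, disjoint except at common end points, the boundary vertex of a side
lies in the relative interior of this side, everything else lies in the interior of the prototile,
and the distinguished interior vertex is the puncture, i.e. the origin. A dual tree is the case of
a single interior vertex with one edge to every boundary vertex. -/
structure QuasiDualTree {P σ I E : Type*} {𝒬 : PrototileSet P} {B : SideStructure 𝒬 σ}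
    (Γ : TreeShape B I E) where
  pos : σ ⊕ I → Plane
  arc : E → Set Plane
  isArc : ∀ e, IsArc (arc e) (pos (Γ.src e)) (pos (Γ.tgt e))
  pos_boundary : ∀ s, pos (Sum.inl s) ∈ B.carrier s \ {B.fst s, B.snd s}
  pos_interior : ∀ i, pos (Sum.inr i) ∈ interior (𝒬.supp (Γ.intOwner i))
  pos_puncture : ∀ p, pos (Sum.inr (Γ.puncture p)) = 0
  pos_injOn : ∀ u v, Γ.vertexOwner u = Γ.vertexOwner v → pos u = pos v → u = v
  arc_interior : ∀ e,
    arc e \ {pos (Γ.src e), pos (Γ.tgt e)} ⊆ interior (𝒬.supp (Γ.owner e))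
  arc_inter : ∀ e f, e ≠ f → Γ.owner e = Γ.owner f →
    arc e ∩ arc f ⊆
      {pos (Γ.src e), pos (Γ.tgt e)} ∩ {pos (Γ.src f), pos (Γ.tgt f)}

section Trees

variable {P σ I E : Type*} {𝒬 : PrototileSet P} {B : SideStructure 𝒬 σ} {Γ : TreeShape B I E}
  (ω : Substitution 𝒬) (N : ℕ)

/-- Consistency: where edges of two tiles of a tiling coincide, so do their boundary vertices. -/
def QuasiDualTree.IsConsistent (G : QuasiDualTree Γ) : Prop :=
  ∀ p, ∀ t ∈ ω.tiling p, ∀ t' ∈ ω.tiling p, ∀ s s' X,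
    B.IsTileSide t s X → B.IsTileSide t' s' X →
      G.pos (Sum.inl s) + t.2 = G.pos (Sum.inl s') + t'.2

/-- The entry `(e, f)` of the edge digit matrix of the pair `(G, S)`, with respect to the `N`-th
power of the substitution: the vectors `x` for which `f + x` lies in a tile of `ω^N(p)`, where `e`
is an edge in `p`, and `λ^{-N} (f + x)` is contained in the edge `ψ(e)` of `S`. -/
def edgeDigits (G S : QuasiDualTree Γ) (e f : E) : Set Plane :=
  {x | (Γ.owner f, x) ∈ ω.supertile N (Γ.owner e) ∧
    dilate (ω.scale ^ N)⁻¹ (translate (G.arc f) x) ⊆ S.arc e}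

/-- `(G, S)` is a recurrent pair, `S ⊆ R^N(G)`: every edge of `S` is composed of edges of `R^N(G)`,
i.e. of sets `λ^{-N} (f + x)`, where `f` is an edge of `G_q` and `q + x` is a tile of `ω^N(p)`. The
homeomorphism `ψ : G → S` is the identification of the edges and vertices of `G` and `S` through
their common combinatorial type. -/
def IsRecurrentPair (G S : QuasiDualTree Γ) : Prop :=
  G.IsConsistent ω ∧ S.IsConsistent ω ∧
    ∀ e, S.arc e =
      ⋃ f, ⋃ x ∈ edgeDigits ω N G S e f, dilate (ω.scale ^ N)⁻¹ (translate (G.arc f) x)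

/-- `A` is the fractal graph of the recurrent pair `(G, S)`: a consistent (quasi-)dual tree whose
edges form the attractor (the unique invariant family of non-empty compact sets) of the graph
iterated function system given by the edge digit matrix. -/
def IsFractalGraph (G S A : QuasiDualTree Γ) : Prop :=
  A.IsConsistent ω ∧
    ∀ e, A.arc e =
      ⋃ f, ⋃ x ∈ edgeDigits ω N G S e f, dilate (ω.scale ^ N)⁻¹ (translate (A.arc f) x)

/-- The edge substitution matrix of the pair `(G, S)`. -/
def edgeMatrix (G S : QuasiDualTree Γ) : Matrix E E ℝ :=
  Matrix.of fun e f => (Set.ncard (edgeDigits ω N G S e f) : ℝ)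

/-- `κ` and `v` are the Perron-Frobenius eigenvalue and a (positive, right) Perron-Frobenius
eigenvector of a primitive matrix. -/
def IsPerronFrobenius [Fintype E] (M : Matrix E E ℝ) (κ : ℝ) (v : E → ℝ) : Prop :=
  (∀ e, 0 < v e) ∧ M.mulVec v = κ • v

/-! ### Fractal trees

A pair `(e, x) : E × Plane` stands for the translate `A_e + x` of an edge of the fractal graph. -/

/-- The graph, with vertices points of the plane, formed by a set of translated edges. -/
def placedGraph (A : QuasiDualTree Γ) (F : Set (E × Plane)) : SimpleGraph Plane :=
  SimpleGraph.fromRel fun a b =>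
    ∃ k ∈ F, A.pos (Γ.src k.1) + k.2 = a ∧ A.pos (Γ.tgt k.1) + k.2 = b

/-- A set of translated edges forms a connected tree. -/
def IsConnectedTree (A : QuasiDualTree Γ) (F : Set (E × Plane)) : Prop :=
  (placedGraph A F).IsAcyclic ∧
  (∀ a ∈ (placedGraph A F).support, ∀ b ∈ (placedGraph A F).support,
    (placedGraph A F).Reachable a b) ∧
  ∀ k ∈ F, ∀ l ∈ F, s(A.pos (Γ.src k.1) + k.2, A.pos (Γ.tgt k.1) + k.2) =
    s(A.pos (Γ.src l.1) + l.2, A.pos (Γ.tgt l.1) + l.2) → k = l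

/-- The translated edge `(f, x)`, shrunk by `λ^{-N}`, is an edge of the graph `A°`: it is one of the
edges of `R^N(A)` of which an edge `A_e` of `A_p` consists, and no end point of it is a boundary
vertex of `A_p`. -/
def IsInnerEdge (G S A : QuasiDualTree Γ) (p : P) (k : E × Plane) : Prop :=
  (∃ e, Γ.owner e = p ∧ k.2 ∈ edgeDigits ω N G S e k.1) ∧
  ∀ s, B.owner s = p → ∀ w ∈ ({Γ.src k.1, Γ.tgt k.1} : Set (σ ⊕ I)),
    (ω.scale ^ N)⁻¹ • (A.pos w + k.2) ≠ A.pos (Sum.inl s)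

/-- The family `F_1 ⊆ R^N(A)` from which the fractal trees are built; `F p` is the graph
`λ^N (F_1)_p`, a set of edges of the copies of `A` in the tiles of `ω^N(p)`. It is a connected tree,
contains the puncture of each tile of `ω^N(p)`, lies in the interior of the support of `ω^N(p)`, and
contains the graph `A°`. -/
structure IsInitialTree (G S A : QuasiDualTree Γ) (F : P → Set (E × Plane)) : Prop where
  mem_supertile : ∀ p, ∀ k ∈ F p, (Γ.owner k.1, k.2) ∈ ω.supertile N p
  isConnectedTree : ∀ p, IsConnectedTree A (F p)
  puncture_mem : ∀ p, ∀ t ∈ ω.supertile N p, t.2 ∈ (placedGraph A (F p)).support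
  subset_interior : ∀ p, ∀ k ∈ F p,
    translate (A.arc k.1) k.2 ⊆ interior (dilate (ω.scale ^ N) (𝒬.supp p))
  inner_mem : ∀ p, ∀ k : E × Plane, IsInnerEdge ω N G S A p k → k ∈ F p

/-- The graphs `λ^{N (n + 1)} (F_{n+1})_p`, where `F_{n+1} = R^N(F_n) ∪ F_n`, as sets of translated
edges of `A`. In the recursion step the first set is `R^N(F_n)`; in the second one each edge of
`F_n` is replaced by the edges of which it consists. -/
def levelTree (G S : QuasiDualTree Γ) (F : P → Set (E × Plane)) : ℕ → P → Set (E × Plane)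
  | 0 => F
  | n + 1 => fun p =>
      {k | ∃ t ∈ ω.supertile N p, ∃ l ∈ levelTree G S F n t.1,
        k = (l.1, l.2 + (ω.scale ^ N) ^ (n + 1) • t.2)} ∪
      {k | ∃ l ∈ levelTree G S F n p, ∃ z ∈ edgeDigits ω N G S l.1 k.1,
        k.2 = z + ω.scale ^ N • l.2}

/-- The fractal tree `𝔉_p` on the tiling `T_p`, as a set of translated edges of `A`. -/
def fractalTree (G S : QuasiDualTree Γ) (F : P → Set (E × Plane)) (p : P) : Set (E × Plane) :=
  ⋃ n, levelTree ω N G S F n p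

/-- The length of the edge between two adjacent vertices, when the translates of `A_e` have
length `v e` (the infimum is over a one-point set if there are no parallel edges). -/
def edgeLength (A : QuasiDualTree Γ) (v : E → ℝ) (F : Set (E × Plane)) (a b : Plane) : ℝ :=
  sInf {r | ∃ k ∈ F,
    s(A.pos (Γ.src k.1) + k.2, A.pos (Γ.tgt k.1) + k.2) = s(a, b) ∧ r = v k.1}

/-- The sum of the lengths of the edges of a walk. -/
def walkLength (A : QuasiDualTree Γ) (v : E → ℝ) (F : Set (E × Plane)) {a b : Plane}
    (w : (placedGraph A F).Walk a b) : ℝ :=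
  (w.darts.map fun d => edgeLength A v F d.fst d.snd).sum

/-- The fractal distance of two tiles: the length of the path (without repeated vertices) between
their punctures (the infimum is over a one-point set, since there is just one such path in a
tree). -/
def fractalDist (A : QuasiDualTree Γ) (v : E → ℝ) (F : Set (E × Plane)) (t t' : Tile P) : ℝ :=
  sInf {r | ∃ w : (placedGraph A F).Walk t.2 t'.2, w.IsPath ∧ r = walkLength A v F w}

end Trees

/-! ### Operators -/

section Operators

variable {H : Type*} [NormedAddCommGroup H] [InnerProductSpace ℂ H] [CompleteSpace H]

/-- A projection-valued measure `E` on the real line, with the scalar measures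
`S ↦ ⟪ξ, E(S) ξ⟫ = ‖E(S) ξ‖²`; countable additivity of `E` is that of these measures. -/
structure SpectralMeasure (H : Type*) [NormedAddCommGroup H] [InnerProductSpace ℂ H]
    [CompleteSpace H] where
  proj : Set ℝ → H →L[ℂ] H
  scalar : H → MeasureTheory.Measure ℝ
  isStarProjection : ∀ S, MeasurableSet S → IsStarProjection (proj S)
  proj_univ : proj Set.univ = 1
  proj_inter : ∀ S T, MeasurableSet S → MeasurableSet T → proj (S ∩ T) = proj S * proj T
  scalar_apply : ∀ ξ S, MeasurableSet S → scalar ξ S = ENNReal.ofReal (‖proj S ξ‖ ^ 2)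

/-- `E` is the spectral measure of the (unbounded, self-adjoint) operator `D`: `D = ∫ x dE(x)`, with
domain `{ξ | ∫ x² d⟪ξ, E(x) ξ⟫ < ∞}`. -/
def SpectralMeasure.IsSpectralMeasureOf (E : SpectralMeasure H) (D : H →ₗ.[ℂ] H) : Prop :=
  (∀ ξ, ξ ∈ D.domain ↔ (∫⁻ x, ENNReal.ofReal (x ^ 2) ∂(E.scalar ξ)) < ⊤) ∧
  ∀ ξ : D.domain, inner ℂ (ξ : H) (D ξ) = ((∫ x, x ∂(E.scalar (ξ : H)) : ℝ) : ℂ)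

/-- The bounded operator `K` is `f(D)` in the sense of the Borel functional calculus, for a bounded
measurable function `f`: `K = ∫ f(x) dE(x)`, where `E` is the spectral measure of `D`. -/
def IsFunctionOf (D : H →ₗ.[ℂ] H) (f : ℝ → ℝ) (K : H →L[ℂ] H) : Prop :=
  ∃ E : SpectralMeasure H, E.IsSpectralMeasureOf D ∧
    ∀ ξ, inner ℂ ξ (K ξ) = ((∫ x, f x ∂(E.scalar ξ) : ℝ) : ℂ)

/-- `K` is trace class: `Tr |K| = ∑ᵢ ⟪bᵢ, |K| bᵢ⟫ < ∞`, where `|K| = (K* K)^{1/2}`, for every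
orthonormal basis `b`. -/
def IsTraceClass (K : H →L[ℂ] H) : Prop :=
  ∀ (s : Set H) (b : HilbertBasis s ℂ H),
    Summable fun i => (inner ℂ (b i) (CFC.abs K (b i))).re

/-- The self-adjoint operator on `ℓ²(ι)` with `δ_t ↦ a(t) δ_t`; its domain consists of the `ξ` for
which `t ↦ a(t) ξ(t)` is square summable. -/
def diagonalOperator {ι : Type*} (a : ι → ℝ) :
    lp (fun _ : ι => ℂ) 2 →ₗ.[ℂ] lp (fun _ : ι => ℂ) 2 where
  domain :=
    { carrier := {ξ | Memℓp (fun t => (a t : ℂ) * ξ t) 2}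
      add_mem' := by
        intro ξ η hξ hη
        have h := Memℓp.add hξ hη
        have e : (fun t => (a t : ℂ) * (ξ + η) t)
            = (fun t => (a t : ℂ) * ξ t) + (fun t => (a t : ℂ) * η t) := by
          funext t
          simp [mul_add]
        simpa only [Set.mem_ofPred_eq, e] using h
      zero_mem' := by
        have e : (fun t => (a t : ℂ) * (0 : lp (fun _ : ι => ℂ) 2) t) = 0 := by
          funext t
          simp
        simpa only [Set.mem_ofPred_eq, e] using zero_memℓp
      smul_mem' := by
        intro c ξ hξ
        have h := Memℓp.const_smul hξ c
        have e : (fun t => (a t : ℂ) * (c • ξ) t) = c • (fun t => (a t : ℂ) * ξ t) := by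
          funext t
          simp [mul_left_comm]
        simpa only [Set.mem_ofPred_eq, e] using h }
  toFun :=
    { toFun := fun ξ => ⟨fun t => (a t : ℂ) * (ξ : lp (fun _ : ι => ℂ) 2) t, ξ.2⟩
      map_add' := by
        intro ξ η
        ext t
        exact mul_add _ _ _
      map_smul' := by
        intro c ξ
        ext t
        exact mul_left_comm _ _ _ }

end Operators

section Dirac

variable {P σ I E : Type*} {𝒬 : PrototileSet P} {B : SideStructure 𝒬 σ} {Γ : TreeShape B I E}

/-- The set `T_p \ {p}`. -/
def puncturedTiling (ω : Substitution 𝒬) (p : P) : Set (Tile P) := ω.tiling p \ {(p, 0)}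

/-- The Hilbert space `H_p = ℓ²(T_p \ {p})`. -/
abbrev tilingSpace (ω : Substitution 𝒬) (p : P) :=
  lp (fun _ : puncturedTiling ω p => ℂ) 2

/-- The operator `D_p` on `ℓ²(T_p \ {p})`, with `D_p δ_t = ln (d(t, p)) δ_t`, where `d` is the
fractal distance given by the fractal tree `𝔉_p`. -/
def dirac (ω : Substitution 𝒬) (N : ℕ) (G S A : QuasiDualTree Γ) (v : E → ℝ)
    (F : P → Set (E × Plane)) (p : P) : tilingSpace ω p →ₗ.[ℂ] tilingSpace ω p :=
  diagonalOperator fun t => Real.log (fractalDist A v (fractalTree ω N G S F p) t.1 (p, 0))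

end Dirac

end FractalTiling

end

noncomputable section

namespace FractalTiling

open MeasureTheory

/-! The operator `D_p` is diagonal, so `exp(-α D_p²)` is the positive diagonal operator with
eigenvalues `exp(-α ln² d(t,p))`, and it suffices that these are summable over `t ≠ p`
(`exists_isFunctionOf_exp_isTraceClass`). The function `exp(-α ln² r)` decays faster than every
power of `r`; the bound by a multiple of `r⁻³` is enough (`exp_neg_mul_log_sq_le`).

There are finitely many edges up to translation, so edge lengths are bounded below and the distances
between the end points of edges are bounded above. Hence the fractal distance is at least a constant
times the Euclidean one (`exists_mul_dist_le_fractalDist`). The punctures are uniformly separated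
because each prototile contains a ball about its puncture, so the inverse cubes of their norms have
a finite sum in the plane (`summable_norm_rpow_neg_three`).

The lower bound needs a path to exist: over an empty set of paths the infimum would be `0`. Most of
the geometry therefore serves `reachable_fractalTree`. Its topological core is that an arc composed
of finitely many arcs that meet only at common end points yields a path in the graph of these pieces
(`IsArc.reachable_of_eq_biUnion`), so connectedness survives scaling and subdivision. -/

lemma abs_eq_self_of_isPositive {H : Type*} [NormedAddCommGroup H] [InnerProductSpace ℂ H]
    [CompleteSpace H] {K : H →L[ℂ] H} (hK : K.IsPositive) : CFC.abs K = K :=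
  CFC.abs_of_nonneg K ((ContinuousLinearMap.nonneg_iff_isPositive _).2 hK)

/-! ### Diagonal operators: spectral measure, functional calculus, trace class. -/

section Diagonal

variable {ι : Type*}

lemma memℓp_two_iff {f : ι → ℂ} : Memℓp f 2 ↔ Summable fun t => ‖f t‖ ^ 2 := by
  rw [memℓp_gen_iff (by norm_num)]
  simp

lemma summable_norm_sq (ξ : lp (fun _ : ι => ℂ) 2) : Summable fun t => ‖ξ t‖ ^ 2 :=
  memℓp_two_iff.1 (lp.memℓp ξ)

lemma norm_sq_eq_tsum (ξ : lp (fun _ : ι => ℂ) 2) : ‖ξ‖ ^ 2 = ∑' t, ‖ξ t‖ ^ 2 := by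
  have h := lp.norm_rpow_eq_tsum (p := 2) (by norm_num) ξ
  simpa using h

lemma norm_mul_sq_le {c : ℝ} (hc : |c| ≤ 1) (z : ℂ) : ‖(c : ℂ) * z‖ ^ 2 ≤ ‖z‖ ^ 2 := by
  rw [norm_mul, mul_pow, Complex.norm_real, Real.norm_eq_abs]
  exact mul_le_of_le_one_left (by positivity) (pow_le_one₀ (abs_nonneg c) hc)

lemma memℓp_contraction_mul {k : ι → ℝ} (hk : ∀ t, |k t| ≤ 1) (ξ : lp (fun _ : ι => ℂ) 2) :
    Memℓp (fun t => (k t : ℂ) * ξ t) 2 :=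
  memℓp_two_iff.2 <| (summable_norm_sq ξ).of_nonneg_of_le (fun _ => by positivity)
    fun t => norm_mul_sq_le (hk t) _

/-- The contraction `δ_t ↦ k(t) δ_t` of `ℓ²(ι)`, where `|k| ≤ 1`. -/
def diagonalContraction (k : ι → ℝ) (hk : ∀ t, |k t| ≤ 1) :
    lp (fun _ : ι => ℂ) 2 →L[ℂ] lp (fun _ : ι => ℂ) 2 :=
  LinearMap.mkContinuous
    { toFun := fun ξ => ⟨fun t => (k t : ℂ) * ξ t, memℓp_contraction_mul hk ξ⟩
      map_add' := by
        intro ξ η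
        ext t
        exact mul_add _ _ _
      map_smul' := by
        intro c ξ
        ext t
        exact mul_left_comm _ _ _ } 1 (by
    intro ξ
    rw [one_mul]
    refine (sq_le_sq₀ (norm_nonneg _) (norm_nonneg _)).1 ?_
    rw [norm_sq_eq_tsum, norm_sq_eq_tsum]
    exact (memℓp_two_iff.1 (memℓp_contraction_mul hk ξ)).tsum_le_tsum
      (fun t => norm_mul_sq_le (hk t) _) (summable_norm_sq ξ))

@[simp]
lemma diagonalContraction_apply (k : ι → ℝ) (hk : ∀ t, |k t| ≤ 1) (ξ : lp (fun _ : ι => ℂ) 2)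
    (t : ι) : diagonalContraction k hk ξ t = (k t : ℂ) * ξ t := rfl

lemma inner_mul_self (c : ℝ) (z : ℂ) : inner ℂ z ((c : ℂ) * z) = ((‖z‖ ^ 2 * c : ℝ) : ℂ) := by
  rw [RCLike.inner_apply, mul_assoc, Complex.mul_conj, Complex.normSq_eq_norm_sq]
  push_cast
  ring

lemma hasSum_inner_diagonal {a : ι → ℝ} {ξ η : lp (fun _ : ι => ℂ) 2}
    (h : ∀ t, η t = (a t : ℂ) * ξ t) :
    HasSum (fun t => ((‖ξ t‖ ^ 2 * a t : ℝ) : ℂ)) (inner ℂ ξ η) := by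
  have h' := lp.hasSum_inner (𝕜 := ℂ) ξ η
  simpa only [h, inner_mul_self] using h'

lemma diagonalContraction_isPositive (k : ι → ℝ) (hk : ∀ t, |k t| ≤ 1) (h0 : ∀ t, 0 ≤ k t) :
    (diagonalContraction k hk).IsPositive := by
  rw [ContinuousLinearMap.isPositive_iff_complex]
  intro ξ
  have h := hasSum_inner_diagonal (ξ := ξ) (diagonalContraction_apply k hk ξ)
  have hr := Complex.hasSum_re h
  have hi := Complex.hasSum_im h
  simp only [Complex.ofReal_re, Complex.ofReal_im] at hr hi
  have hi0 := hi.unique hasSum_zero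
  have hr0 : 0 ≤ (inner ℂ ξ (diagonalContraction k hk ξ)).re :=
    hr.nonneg fun t => mul_nonneg (by positivity) (h0 t)
  have hs : inner ℂ (diagonalContraction k hk ξ) ξ = inner ℂ ξ (diagonalContraction k hk ξ) := by
    rw [← inner_conj_symm]
    exact Complex.conj_eq_iff_im.2 hi0
  rw [hs]
  exact ⟨Complex.ext (by simp) (by simpa using hi0.symm), hr0⟩

/-- The scalar measure `∑_t |ξ(t)|² δ_{a(t)}` of the diagonal operator with eigenvalues `a(t)`. -/
def diagonalScalar (a : ι → ℝ) (ξ : lp (fun _ : ι => ℂ) 2) : Measure ℝ :=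
  Measure.sum fun t => ENNReal.ofReal (‖ξ t‖ ^ 2) • Measure.dirac (a t)

lemma lintegral_diagonalScalar (a : ι → ℝ) (ξ : lp (fun _ : ι => ℂ) 2) (g : ℝ → ENNReal) :
    ∫⁻ x, g x ∂(diagonalScalar a ξ) = ∑' t, ENNReal.ofReal (‖ξ t‖ ^ 2) * g (a t) := by
  simp [diagonalScalar, lintegral_sum_measure, lintegral_smul_measure]

lemma integral_diagonalScalar (a : ι → ℝ) (ξ : lp (fun _ : ι => ℂ) 2) {g : ℝ → ℝ}
    (hg : Measurable g) (hs : Summable fun t => ‖ξ t‖ ^ 2 * |g (a t)|) :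
    ∫ x, g x ∂(diagonalScalar a ξ) = ∑' t, ‖ξ t‖ ^ 2 * g (a t) := by
  have hi : Integrable g (diagonalScalar a ξ) := by
    refine ⟨hg.aestronglyMeasurable, ?_⟩
    rw [hasFiniteIntegral_iff_enorm, lintegral_diagonalScalar]
    convert hs.tsum_ofReal_lt_top using 3 with t
    rw [ENNReal.ofReal_mul (by positivity), Real.enorm_eq_ofReal_abs]
  have h := (hasSum_integral_measure hi).tsum_eq
  rw [diagonalScalar, ← h]
  refine tsum_congr fun t => ?_
  rw [integral_smul_measure, integral_dirac, ENNReal.toReal_ofReal (by positivity), smul_eq_mul]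

/-- Integrability comes for free: the series of the inner product of two `ℓ²` vectors converges
absolutely. With `g = id` this identifies the operator itself, with bounded `g` its functional
calculus. -/
lemma inner_diagonal_eq_integral {a : ι → ℝ} {g : ℝ → ℝ} (hg : Measurable g)
    {ξ η : lp (fun _ : ι => ℂ) 2} (h : ∀ t, η t = (g (a t) : ℂ) * ξ t) :
    inner ℂ ξ η = ((∫ x, g x ∂(diagonalScalar a ξ) : ℝ) : ℂ) := by
  have hs := hasSum_inner_diagonal h
  have hn := hs.summable.norm
  rw [integral_diagonalScalar a ξ hg, ← hs.tsum_eq, Complex.ofReal_tsum]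
  refine hn.congr fun t => ?_
  rw [Complex.norm_real, Real.norm_eq_abs, abs_mul, abs_of_nonneg (by positivity)]

lemma abs_indicator_one_le (X : Set ι) (t : ι) : |X.indicator (1 : ι → ℝ) t| ≤ 1 := by
  by_cases h : t ∈ X <;> simp [h]

/-- The spectral measure of the diagonal operator with eigenvalues `a(t)`. -/
def diagonalSpectralMeasure (a : ι → ℝ) : SpectralMeasure (lp (fun _ : ι => ℂ) 2) where
  proj X := diagonalContraction ((a ⁻¹' X).indicator 1) (abs_indicator_one_le _)
  scalar := diagonalScalar a
  isStarProjection X _ := by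
    classical
    refine ⟨?_, (diagonalContraction_isPositive _ _ fun t =>
      Set.indicator_nonneg (fun _ _ => zero_le_one) t).isSelfAdjoint⟩
    ext ξ t
    by_cases h : a t ∈ X <;> simp [h]
  proj_univ := by
    ext ξ t
    simp
  proj_inter X Y _ _ := by
    classical
    ext ξ t
    by_cases h : a t ∈ X <;> by_cases h' : a t ∈ Y <;> simp [h, h']
  scalar_apply ξ X hX := by
    classical
    rw [norm_sq_eq_tsum, ENNReal.ofReal_tsum_of_nonneg (fun _ => by positivity)
      (summable_norm_sq _), diagonalScalar, Measure.sum_apply _ hX]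
    refine tsum_congr fun t => ?_
    by_cases h : a t ∈ X <;> simp [h, hX]

lemma diagonalSpectralMeasure_isSpectralMeasureOf (a : ι → ℝ) :
    (diagonalSpectralMeasure a).IsSpectralMeasureOf (diagonalOperator a) := by
  refine ⟨fun ξ => ?_, fun _ => inner_diagonal_eq_integral measurable_id fun _ => rfl⟩
  change Memℓp (fun t => (a t : ℂ) * ξ t) 2 ↔
    ∫⁻ x, ENNReal.ofReal (x ^ 2) ∂(diagonalScalar a ξ) < ⊤
  rw [memℓp_two_iff, lintegral_diagonalScalar]
  have e : ∀ t, ENNReal.ofReal (‖ξ t‖ ^ 2) * ENNReal.ofReal (a t ^ 2)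
      = ENNReal.ofReal (‖(a t : ℂ) * ξ t‖ ^ 2) := by
    intro t
    rw [← ENNReal.ofReal_mul (by positivity), norm_mul, Complex.norm_real, Real.norm_eq_abs,
      mul_pow, sq_abs, mul_comm]
  simp only [e]
  refine ⟨fun h => h.tsum_ofReal_lt_top, fun h => ?_⟩
  have h' := ENNReal.summable_toReal h.ne
  exact h'.congr fun t => ENNReal.toReal_ofReal (by positivity)

lemma isFunctionOf_diagonal (a : ι → ℝ) {f : ℝ → ℝ} (hf : Measurable f)
    (hk : ∀ t, |f (a t)| ≤ 1) :
    IsFunctionOf (diagonalOperator a) f (diagonalContraction (fun t => f (a t)) hk) :=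
  ⟨diagonalSpectralMeasure a, diagonalSpectralMeasure_isSpectralMeasureOf a,
    fun _ => inner_diagonal_eq_integral hf fun _ => rfl⟩

/-- By positivity `|K| = K`. Exchanging sums, a finite part of the trace is `∑ₜ k(t) ∑ᵢ |bᵢ(t)|²`,
and the inner sum is at most `1`. -/
lemma isTraceClass_diagonal {k : ι → ℝ} (hk : ∀ t, |k t| ≤ 1) (h0 : ∀ t, 0 ≤ k t)
    (hs : Summable k) : IsTraceClass (diagonalContraction k hk) := by
  classical
  intro s b
  have hpos := diagonalContraction_isPositive k hk h0
  rw [abs_eq_self_of_isPositive hpos]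
  have hsum : ∀ i, HasSum (fun t => ‖b i t‖ ^ 2 * k t)
      (inner ℂ (b i) (diagonalContraction k hk (b i))).re := by
    intro i
    have h := Complex.hasSum_re
      (hasSum_inner_diagonal (ξ := b i) (diagonalContraction_apply k hk (b i)))
    simpa only [Complex.ofReal_re] using h
  refine summable_of_sum_le (c := ∑' t, k t)
    (fun i => (hsum i).nonneg fun t => mul_nonneg (by positivity) (h0 t)) fun u => ?_
  have h := hasSum_sum (s := u) fun i _ => hsum i
  refine hasSum_le (fun t => ?_) h hs.hasSum
  rw [← Finset.sum_mul]
  refine mul_le_of_le_one_left (h0 t) ?_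
  -- Bessel's inequality for the unit vector `δ_t`.
  have hB := b.orthonormal.sum_inner_products_le (s := u) (lp.single 2 t (1 : ℂ))
  have e : ∀ i, ‖inner ℂ (b i) (lp.single 2 t (1 : ℂ))‖ = ‖b i t‖ := by
    intro i
    rw [← inner_conj_symm, lp.inner_single_left]
    simp
  simpa [e, lp.norm_single] using hB

end Diagonal

open Topology

/-! ### Tiles and supertiles -/

lemma translate_eq_image (X : Set Plane) (x : Plane) :
    translate X x = Homeomorph.addRight x '' X := rfl

lemma dilate_eq_image {c : ℝ} (hc : c ≠ 0) (X : Set Plane) :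
    dilate c X = Homeomorph.smulOfNeZero c hc '' X := rfl

lemma interior_translate (X : Set Plane) (x : Plane) :
    interior (translate X x) = translate (interior X) x := by
  rw [translate_eq_image, translate_eq_image, Homeomorph.image_interior]

lemma closure_translate (X : Set Plane) (x : Plane) :
    closure (translate X x) = translate (closure X) x := by
  rw [translate_eq_image, translate_eq_image, Homeomorph.image_closure]

lemma interior_dilate {c : ℝ} (hc : c ≠ 0) (X : Set Plane) :
    interior (dilate c X) = dilate c (interior X) := by
  rw [dilate_eq_image hc, dilate_eq_image hc, Homeomorph.image_interior]

lemma disjoint_translate {X Y : Set Plane} (h : Disjoint X Y) (x : Plane) :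
    Disjoint (translate X x) (translate Y x) :=
  (Set.disjoint_image_iff (Homeomorph.addRight x).injective).2 h

lemma disjoint_dilate {X Y : Set Plane} (h : Disjoint X Y) {c : ℝ} (hc : c ≠ 0) :
    Disjoint (dilate c X) (dilate c Y) :=
  (Set.disjoint_image_iff (Homeomorph.smulOfNeZero c hc).injective).2 h

lemma translate_translate (X : Set Plane) (x y : Plane) :
    translate (translate X x) y = translate X (x + y) := by
  simp only [translate, Set.image_image, add_assoc]

lemma translate_dilate (X : Set Plane) (c : ℝ) (x : Plane) :
    translate (dilate c X) (c • x) = dilate c (translate X x) := by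
  simp only [translate, dilate, Set.image_image, smul_add]

namespace PrototileSet

variable {P : Type*} (𝒬 : PrototileSet P)

lemma closure_interior_tileSupp (t : Tile P) :
    closure (interior (𝒬.tileSupp t)) = 𝒬.tileSupp t := by
  rw [tileSupp, interior_translate, closure_translate, 𝒬.closure_interior_supp]

end PrototileSet

namespace Substitution

variable {P : Type*} {𝒬 : PrototileSet P} (ω : Substitution 𝒬)

lemma scale_ne_zero : ω.scale ≠ 0 := (zero_lt_one.trans ω.one_lt_scale).ne'

lemma supertile_succ (n : ℕ) (p : P) : ω.supertile (n + 1) p = ω.apply (ω.supertile n p) :=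
  Function.iterate_succ_apply' _ _ _

lemma mem_iterate_apply {m : ℕ} {X : Set (Tile P)} {s : Tile P} :
    s ∈ ω.apply^[m] X ↔
      ∃ t ∈ X, ∃ u ∈ ω.supertile m t.1, s = (u.1, u.2 + ω.scale ^ m • t.2) := by
  induction m generalizing s with
  | zero => simp [supertile]
  | succ m ih =>
    rw [Function.iterate_succ_apply']
    constructor
    · rintro ⟨r, hr, u, hu, rfl⟩
      obtain ⟨t, ht, w, hw, rfl⟩ := ih.1 hr
      refine ⟨t, ht, (u.1, u.2 + ω.scale • w.2), ?_, ?_⟩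
      · rw [supertile_succ]
        exact ⟨w, hw, u, hu, rfl⟩
      · simp only [smul_add, pow_succ', mul_smul, add_assoc]
    · rintro ⟨t, ht, r, hr, rfl⟩
      rw [supertile_succ] at hr
      obtain ⟨w, hw, u, hu, rfl⟩ := hr
      refine ⟨_, ih.2 ⟨t, ht, w, hw, rfl⟩, u, hu, ?_⟩
      simp only [smul_add, pow_succ', mul_smul, add_assoc]

lemma mem_supertile_add {m n : ℕ} {p : P} {s : Tile P} :
    s ∈ ω.supertile (m + n) p ↔ ∃ t ∈ ω.supertile n p, ∃ u ∈ ω.supertile m t.1,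
      s = (u.1, u.2 + ω.scale ^ m • t.2) := by
  rw [supertile, Function.iterate_add_apply, mem_iterate_apply]
  rfl

lemma finite_supertile (n : ℕ) (p : P) : (ω.supertile n p).Finite := by
  induction n with
  | zero => exact Set.finite_singleton _
  | succ n ih =>
    rw [supertile_succ]
    refine (ih.biUnion fun t _ =>
      (ω.rule t.1).finite_toSet.image fun u => (u.1, u.2 + ω.scale • t.2)).subset ?_
    rintro s ⟨t, ht, u, hu, rfl⟩
    exact Set.mem_biUnion ht ⟨u, hu, rfl⟩

variable {ω}

lemma FixesPrototiles.puncture_mem_supertile (h : ω.FixesPrototiles) (n : ℕ) (p : P) :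
    (p, (0 : Plane)) ∈ ω.supertile n p := by
  induction n with
  | zero => exact Set.mem_singleton _
  | succ n ih =>
    rw [supertile_succ]
    exact ⟨_, ih, _, h p, by simp⟩

/-- Since `p` itself, untranslated, lies in `ω^k(p)`, the patch `ω^m(p)` is one of the constituents
of `ω^(m+k)(p)`. -/
lemma FixesPrototiles.monotone_supertile (h : ω.FixesPrototiles) (p : P) :
    Monotone fun n => ω.supertile n p := by
  intro m n hmn s hs
  obtain ⟨k, rfl⟩ := Nat.exists_eq_add_of_le hmn
  exact ω.mem_supertile_add.2 ⟨_, h.puncture_mem_supertile k p, s, hs, by simp⟩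

variable (ω)

lemma tileSupp_subset_dilate {t u : Tile P} (hu : u ∈ ω.rule t.1) :
    𝒬.tileSupp (u.1, u.2 + ω.scale • t.2) ⊆ dilate ω.scale (𝒬.tileSupp t) := by
  rw [PrototileSet.tileSupp, PrototileSet.tileSupp, ← translate_translate, ← translate_dilate,
    ← ω.cover]
  exact Set.image_mono (Set.subset_biUnion_of_mem (u := fun t => 𝒬.tileSupp t) hu)

lemma disjoint_interior_supertile (n : ℕ) (p : P) :
    ∀ t ∈ ω.supertile n p, ∀ t' ∈ ω.supertile n p, t ≠ t' →
      Disjoint (interior (𝒬.tileSupp t)) (interior (𝒬.tileSupp t')) := by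
  induction n with
  | zero =>
    intro t ht t' ht' hne
    exact absurd (Set.mem_singleton_iff.1 ht |>.trans (Set.mem_singleton_iff.1 ht').symm) hne
  | succ n ih =>
    rw [supertile_succ]
    rintro _ ⟨t, ht, u, hu, rfl⟩ _ ⟨t', ht', u', hu', rfl⟩ hne
    -- Tiles with the same parent are separated by the substitution rule; tiles with different
    -- parents lie in the scaled supports of these, which are separated by induction.
    by_cases h : t = t'
    · subst h
      have hd := ω.disjoint_interior t.1 u hu u' hu' fun h => hne (by rw [h])
      have hd' := disjoint_translate hd (ω.scale • t.2)
      rwa [← interior_translate, ← interior_translate, PrototileSet.tileSupp,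
        PrototileSet.tileSupp, translate_translate, translate_translate] at hd'
    · have hd := disjoint_dilate (ih t ht t' ht' h) ω.scale_ne_zero
      rw [← interior_dilate ω.scale_ne_zero, ← interior_dilate ω.scale_ne_zero] at hd
      exact hd.mono (interior_mono (ω.tileSupp_subset_dilate hu))
        (interior_mono (ω.tileSupp_subset_dilate hu'))

/-- A tile is the closure of its interior, so an open set that misses the interior misses the whole
tile. -/
lemma disjoint_interior_tileSupp {n : ℕ} {p : P} {t t' : Tile P} (ht : t ∈ ω.supertile n p)
    (ht' : t' ∈ ω.supertile n p) (h : t ≠ t') :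
    Disjoint (interior (𝒬.tileSupp t)) (𝒬.tileSupp t') := by
  rw [← 𝒬.closure_interior_tileSupp t']
  exact (ω.disjoint_interior_supertile n p t ht t' ht' h).closure_right isOpen_interior

/-- The punctures of distinct tiles of a tiling are uniformly separated. -/
lemma exists_le_dist_puncture [Finite P] (hfix : ω.FixesPrototiles) :
    ∃ δ > 0, ∀ p, ∀ t ∈ ω.tiling p, ∀ t' ∈ ω.tiling p, t ≠ t' → δ ≤ dist t.2 t'.2 := by
  -- One radius serves the finitely many prototiles. Two punctures closer than this would place one
  -- of them in the interiors of both tiles.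
  have hb : ∀ᶠ δ : ℝ in 𝓝[>] 0, ∀ p, Metric.ball 0 δ ⊆ interior (𝒬.supp p) := by
    rw [Filter.eventually_all]
    intro p
    obtain ⟨δ, hδ, h⟩ := Metric.isOpen_iff.1 isOpen_interior _ (𝒬.zero_mem_interior p)
    filter_upwards [Ioo_mem_nhdsGT hδ] with ε hε
    exact (Metric.ball_subset_ball hε.2.le).trans h
  obtain ⟨δ, h, hδ⟩ := (hb.and self_mem_nhdsWithin).exists
  refine ⟨δ, hδ, fun p t ht t' ht' hne => ?_⟩
  obtain ⟨m, hm⟩ := Set.mem_iUnion.1 ht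
  obtain ⟨m', hm'⟩ := Set.mem_iUnion.1 ht'
  have hd := ω.disjoint_interior_supertile (max m m') p t
    (hfix.monotone_supertile p (le_max_left _ _) hm) t'
    (hfix.monotone_supertile p (le_max_right _ _) hm') hne
  by_contra! hlt
  have hball : ∀ (s : Tile P) (y : Plane), dist y s.2 < δ → y ∈ interior (𝒬.tileSupp s) := by
    intro s y hy
    rw [PrototileSet.tileSupp, interior_translate]
    exact ⟨y - s.2, h s.1 (by simpa [dist_eq_norm] using hy), sub_add_cancel _ _⟩
  exact Set.disjoint_left.1 hd (hball t t.2 (by simpa using hδ)) (hball t' t.2 hlt)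

end Substitution

/-! ### Arcs -/

namespace IsArc

variable {X Y : Set Plane} {a b c d : Plane}

lemma symm (h : IsArc X a b) : IsArc X b a := by
  obtain ⟨f, hf, rfl, rfl, rfl⟩ := h
  refine ⟨f.comp ⟨unitInterval.symm, unitInterval.continuous_symm⟩,
    hf.comp unitInterval.symm_bijective.injective, ?_, by simp, by simp⟩
  exact unitInterval.symm_bijective.surjective.range_comp f

lemma image (h : IsArc X a b) (φ : Plane ≃ₜ Plane) : IsArc (φ '' X) (φ a) (φ b) := by
  obtain ⟨f, hf, rfl, rfl, rfl⟩ := h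
  exact ⟨(φ : C(Plane, Plane)).comp f, φ.injective.comp hf, Set.range_comp φ f, rfl, rfl⟩

lemma isPreconnected (h : IsArc X a b) : IsPreconnected X := by
  obtain ⟨f, -, rfl, -, -⟩ := h
  exact isPreconnected_range f.continuous

lemma isClosed (h : IsArc X a b) : IsClosed X := by
  obtain ⟨f, -, rfl, -, -⟩ := h
  exact (isCompact_range f.continuous).isClosed

lemma fst_mem (h : IsArc X a b) : a ∈ X := by
  obtain ⟨f, -, rfl, rfl, -⟩ := h
  exact Set.mem_range_self _

lemma snd_mem (h : IsArc X a b) : b ∈ X := h.symm.fst_mem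

/-- An end point of an arc is an end point of every subarc that contains it. -/
lemma fst_mem_endpoints (hX : IsArc X a b) (hY : IsArc Y c d) (hYX : Y ⊆ X) (ha : a ∈ Y) :
    a ∈ ({c, d} : Set Plane) := by
  obtain ⟨f, hf, rfl, rfl, rfl⟩ := hX
  obtain ⟨g, hg, rfl, rfl, rfl⟩ := hY
  -- The parametrisation of `Y` factors through that of `X` by a continuous injection `h` of
  -- `[0,1]`. Being strictly monotone, `h` can take the value `0` only at an end of the interval.
  choose h hh using fun s => hYX (Set.mem_range_self s)
  have hc : Continuous h := by
    rw [(f.continuous.isClosedEmbedding hf).isEmbedding.continuous_iff]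
    convert g.continuous using 1
    exact funext hh
  have hi : Function.Injective h := fun s s' e => hg (by rw [← hh, ← hh, e])
  obtain ⟨s, hs⟩ := ha
  have hs0 : h s = 0 := hf (by rw [hh, hs])
  rcases hc.strictMono_of_inj hi with hm | hm
  · have : s ≤ 0 := hm.le_iff_le.1 (hs0.trans_le unitInterval.nonneg')
    left
    rw [← hs, le_antisymm this unitInterval.nonneg']
  · have : 1 ≤ s := hm.le_iff_ge.1 (hs0.trans_le unitInterval.nonneg')
    right
    rw [Set.mem_singleton_iff, ← hs, le_antisymm unitInterval.le_one' this]

/-- If an arc is a finite union of arcs that meet only at common end points, then its end points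
are connected in the graph formed by these arcs. -/
lemma reachable_of_eq_biUnion {κ : Type*} {K : Set κ} (hK : K.Finite) {Z : κ → Set Plane}
    {x y : κ → Plane} (hZ : ∀ k ∈ K, IsArc (Z k) (x k) (y k))
    (hinter : ∀ k ∈ K, ∀ l ∈ K, k ≠ l →
      Z k ∩ Z l ⊆ ({x k, y k} : Set Plane) ∩ {x l, y l})
    (hX : IsArc X a b) (hXZ : X = ⋃ k ∈ K, Z k) {H : SimpleGraph Plane}
    (hH : ∀ k ∈ K, H.Reachable (x k) (y k)) : H.Reachable a b := by
  have hsub : ∀ k ∈ K, Z k ⊆ X := fun k hk => hXZ ▸ Set.subset_biUnion_of_mem hk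
  have hend : ∀ k ∈ K, ∀ z ∈ ({x k, y k} : Set Plane), H.Reachable (x k) z := by
    rintro k hk z (rfl | rfl)
    exacts [SimpleGraph.Reachable.refl _, hH k hk]
  -- Pieces that can and cannot be reached from `a` form two closed sets that cover `X`; a common
  -- point would be a common end point, hence they are disjoint. By connectedness one of them
  -- contains all of `X`.
  let K₁ := {k ∈ K | H.Reachable a (x k)}
  let K₂ := {k ∈ K | ¬ H.Reachable a (x k)}
  have hclosed : ∀ K' ⊆ K, IsClosed (⋃ k ∈ K', Z k) := fun K' h =>
    (hK.subset h).isClosed_biUnion fun k hk => (hZ k (h hk)).isClosed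
  have hcover : X ⊆ (⋃ k ∈ K₁, Z k) ∪ ⋃ k ∈ K₂, Z k := by
    rw [hXZ]
    refine Set.iUnion₂_subset fun k hk z hz => ?_
    by_cases h : H.Reachable a (x k)
    · exact Or.inl (Set.mem_biUnion (show k ∈ K₁ from ⟨hk, h⟩) hz)
    · exact Or.inr (Set.mem_biUnion (show k ∈ K₂ from ⟨hk, h⟩) hz)
  have hdisj : X ∩ ((⋃ k ∈ K₁, Z k) ∩ ⋃ k ∈ K₂, Z k) = ∅ := by
    refine Set.eq_empty_of_forall_notMem ?_
    rintro z ⟨-, h₁, h₂⟩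
    obtain ⟨k, hk, hzk⟩ := Set.mem_iUnion₂.1 h₁
    obtain ⟨l, hl, hzl⟩ := Set.mem_iUnion₂.1 h₂
    have hkl : k ≠ l := by
      rintro rfl
      exact hl.2 hk.2
    obtain ⟨hz, hz'⟩ := hinter k hk.1 l hl.1 hkl ⟨hzk, hzl⟩
    exact hl.2 ((hk.2.trans (hend k hk.1 z hz)).trans (hend l hl.1 z hz').symm)
  rcases isPreconnected_iff_subset_of_disjoint_closed.1 hX.isPreconnected _ _
    (hclosed K₁ (Set.sep_subset _ _)) (hclosed K₂ (Set.sep_subset _ _)) hcover hdisj with h | h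
  -- If the reachable pieces cover `X`, one of them contains `b`, necessarily as an end point.
  -- Otherwise an unreachable piece has `a` as an end point, which is absurd.
  · obtain ⟨k, hk, hz⟩ := Set.mem_iUnion₂.1 (h hX.snd_mem)
    exact hk.2.trans (hend k hk.1 b (hX.symm.fst_mem_endpoints (hZ k hk.1) (hsub k hk.1) hz))
  · obtain ⟨k, hk, hz⟩ := Set.mem_iUnion₂.1 (h hX.fst_mem)
    exact absurd (hend k hk.1 a (hX.fst_mem_endpoints (hZ k hk.1) (hsub k hk.1) hz)).symm hk.2

end IsArc

/-! ### Graphs of translated edges and the subdivision of an edge. -/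

section Graphs

variable {P σ I E : Type*} {𝒬 : PrototileSet P} {B : SideStructure 𝒬 σ} {Γ : TreeShape B I E}

lemma placedGraph_mono (A : QuasiDualTree Γ) {F F' : Set (E × Plane)} (h : F ⊆ F') :
    placedGraph A F ≤ placedGraph A F' := by
  rintro a b ⟨hne, hab⟩
  exact ⟨hne, hab.imp (fun ⟨k, hk, h'⟩ => ⟨k, h hk, h'⟩) fun ⟨k, hk, h'⟩ => ⟨k, h hk, h'⟩⟩

lemma reachable_of_mem (A : QuasiDualTree Γ) {F : Set (E × Plane)} {k : E × Plane} (hk : k ∈ F) :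
    (placedGraph A F).Reachable (A.pos (Γ.src k.1) + k.2) (A.pos (Γ.tgt k.1) + k.2) := by
  -- `SimpleGraph.fromRel` discards loops, so coinciding end points need no edge.
  by_cases h : A.pos (Γ.src k.1) + k.2 = A.pos (Γ.tgt k.1) + k.2
  · rw [h]
  · exact SimpleGraph.Adj.reachable ⟨h, Or.inl ⟨k, hk, rfl, rfl⟩⟩

/-- The map `φ` need not be a graph homomorphism: an edge may become a longer path, as happens under
scaling followed by subdivision. -/
lemma reachable_map (A : QuasiDualTree Γ) {F : Set (E × Plane)} {H : SimpleGraph Plane}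
    {φ : Plane → Plane}
    (h : ∀ k ∈ F, H.Reachable (φ (A.pos (Γ.src k.1) + k.2)) (φ (A.pos (Γ.tgt k.1) + k.2)))
    {a b : Plane} (hab : (placedGraph A F).Reachable a b) : H.Reachable (φ a) (φ b) := by
  obtain ⟨w⟩ := hab
  induction w with
  | nil => rfl
  | cons hadj _ ih =>
    refine SimpleGraph.Reachable.trans ?_ ih
    rcases hadj.2 with ⟨k, hk, rfl, rfl⟩ | ⟨k, hk, rfl, rfl⟩
    exacts [h k hk, (h k hk).symm]

/-- An arc of a quasi-dual tree meets the boundary of the prototile at most in its end points. -/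
lemma QuasiDualTree.mem_endpoints (A : QuasiDualTree Γ) {e : E} {z : Plane} (hz : z ∈ A.arc e)
    (hz' : z ∉ interior (𝒬.supp (Γ.owner e))) :
    z ∈ ({A.pos (Γ.src e), A.pos (Γ.tgt e)} : Set Plane) := by
  by_contra h
  exact hz' (A.arc_interior e ⟨hz, h⟩)

lemma QuasiDualTree.pos_mem_supp (A : QuasiDualTree Γ) (w : σ ⊕ I) :
    A.pos w ∈ 𝒬.supp (Γ.vertexOwner w) := by
  rcases w with s | i
  · have h : A.pos (Sum.inl s) ∈ frontier (𝒬.supp (B.owner s)) := by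
      rw [← B.union_eq]
      exact Set.mem_biUnion (t := fun s => B.carrier s) (show s ∈ {s' | B.owner s' = B.owner s}
        from rfl) (A.pos_boundary s).1
    exact (𝒬.isCompact_supp _).isClosed.frontier_subset h
  · exact interior_subset (A.pos_interior i)

lemma QuasiDualTree.arc_subset_supp (A : QuasiDualTree Γ) (e : E) :
    A.arc e ⊆ 𝒬.supp (Γ.owner e) := by
  intro z hz
  by_cases h : z ∈ interior (𝒬.supp (Γ.owner e))
  · exact interior_subset h
  · rcases A.mem_endpoints hz h with rfl | rfl
    · exact Γ.owner_src e ▸ A.pos_mem_supp _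
    · exact Γ.owner_tgt e ▸ A.pos_mem_supp _

/-- The translated arcs in the tiles of a supertile meet only in common end points. -/
lemma QuasiDualTree.translate_arc_inter (A : QuasiDualTree Γ) (ω : Substitution 𝒬) {n : ℕ} {p : P}
    {k l : E × Plane} (hk : (Γ.owner k.1, k.2) ∈ ω.supertile n p)
    (hl : (Γ.owner l.1, l.2) ∈ ω.supertile n p) (hkl : k ≠ l) :
    translate (A.arc k.1) k.2 ∩ translate (A.arc l.1) l.2 ⊆
      ({A.pos (Γ.src k.1) + k.2, A.pos (Γ.tgt k.1) + k.2} : Set Plane) ∩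
        {A.pos (Γ.src l.1) + l.2, A.pos (Γ.tgt l.1) + l.2} := by
  by_cases h : ((Γ.owner k.1, k.2) : Tile P) = (Γ.owner l.1, l.2)
  · obtain ⟨e, x⟩ := k
    obtain ⟨f, y⟩ := l
    obtain ⟨ho, rfl⟩ := Prod.mk.inj h
    rintro _ ⟨⟨z, hz, rfl⟩, ⟨z', hz', hzz⟩⟩
    obtain rfl : z' = z := add_right_cancel hzz
    have hef : e ≠ f := fun h => hkl (by rw [h])
    simpa using A.arc_inter e f hef ho ⟨hz, hz'⟩
  -- For different tiles, a common point lies outside the interior of either tile, and an arc leaves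
  -- the interior of its prototile only at its end points.
  · have key : ∀ {k l : E × Plane}, (Γ.owner k.1, k.2) ∈ ω.supertile n p →
        (Γ.owner l.1, l.2) ∈ ω.supertile n p →
        ((Γ.owner k.1, k.2) : Tile P) ≠ (Γ.owner l.1, l.2) →
        translate (A.arc k.1) k.2 ∩ translate (A.arc l.1) l.2 ⊆
          ({A.pos (Γ.src k.1) + k.2, A.pos (Γ.tgt k.1) + k.2} : Set Plane) := by
      rintro ⟨e, x⟩ l hk hl h _ ⟨⟨z, hz, rfl⟩, hz'⟩
      have hd := ω.disjoint_interior_tileSupp hk hl h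
      have hl' : z + x ∈ 𝒬.tileSupp (Γ.owner l.1, l.2) :=
        Set.image_mono (A.arc_subset_supp l.1) hz'
      have hn : z ∉ interior (𝒬.supp (Γ.owner e)) := by
        intro hi
        refine Set.disjoint_left.1 hd ?_ hl'
        rw [PrototileSet.tileSupp, interior_translate]
        exact ⟨z, hi, rfl⟩
      simpa using A.mem_endpoints hz hn
    exact fun z hz => ⟨key hk hl h hz, key hl hk (Ne.symm h) ⟨hz.2, hz.1⟩⟩

/-- The scaled end points of an edge of the fractal graph are connected by the edges of which it
consists. -/
lemma reachable_subdivision [Finite E] {ω : Substitution 𝒬} {N : ℕ} {G S A : QuasiDualTree Γ}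
    (hA : IsFractalGraph ω N G S A) (e : E) :
    (placedGraph A {k | k.2 ∈ edgeDigits ω N G S e k.1}).Reachable
      (ω.scale ^ N • A.pos (Γ.src e)) (ω.scale ^ N • A.pos (Γ.tgt e)) := by
  have hc : ω.scale ^ N ≠ 0 := pow_ne_zero _ ω.scale_ne_zero
  have hfin : {k : E × Plane | k.2 ∈ edgeDigits ω N G S e k.1}.Finite := by
    refine ((Set.finite_univ (α := E)).prod
      ((ω.finite_supertile N (Γ.owner e)).image Prod.snd)).subset fun k hk => ?_
    exact ⟨Set.mem_univ _, _, hk.1, rfl⟩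
  refine IsArc.reachable_of_eq_biUnion hfin (Z := fun k => translate (A.arc k.1) k.2)
    (x := fun k => A.pos (Γ.src k.1) + k.2) (y := fun k => A.pos (Γ.tgt k.1) + k.2)
    (fun k _ => (A.isArc k.1).image (Homeomorph.addRight k.2))
    (fun k hk l hl h => A.translate_arc_inter ω hk.1 hl.1 h)
    ((A.isArc e).image (Homeomorph.smulOfNeZero _ hc)) ?_ fun k hk => reachable_of_mem A hk
  rw [hA.2 e]
  simp only [dilate, Set.image_iUnion, Set.image_image]
  ext z
  simp [hc]

end Graphs

/-! ### Connectedness of the fractal tree. -/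

section Levels

variable {P σ I E : Type*} {𝒬 : PrototileSet P} {B : SideStructure 𝒬 σ} {Γ : TreeShape B I E}
  {ω : Substitution 𝒬} {N : ℕ} {G S A : QuasiDualTree Γ} {F : P → Set (E × Plane)}

/-- The induction uses the second set in `levelTree`: scaling by `λ^N` turns every edge of the
previous level into a path of its constituents and fixes the origin. -/
lemma reachable_levelTree_puncture [Finite E] (hfix : ω.FixesPrototiles)
    (hA : IsFractalGraph ω N G S A) (hF : IsInitialTree ω N G S A F) (n : ℕ) (p : P)
    {t : Tile P} (ht : t ∈ ω.supertile N p) :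
    (placedGraph A (levelTree ω N G S F n p)).Reachable 0 ((ω.scale ^ N) ^ n • t.2) := by
  induction n with
  | zero =>
    rw [pow_zero, one_smul]
    exact (hF.isConnectedTree p).2.1 _ (hF.puncture_mem p _ (hfix.puncture_mem_supertile N p)) _
      (hF.puncture_mem p t ht)
  | succ n ih =>
    rw [pow_succ', mul_smul, ← smul_zero (ω.scale ^ N)]
    refine reachable_map A (φ := fun y => ω.scale ^ N • y) (fun l hl => ?_) ih
    simp only [smul_add]
    refine reachable_map A (φ := fun y => y + ω.scale ^ N • l.2) (fun k hk => ?_)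
      (reachable_subdivision hA l.1)
    simp only [add_assoc]
    exact reachable_of_mem A (k := (k.1, k.2 + ω.scale ^ N • l.2)) (Or.inr ⟨l, hl, k.2, hk, rfl⟩)

/-- The induction uses the first set in `levelTree`: inside the supertile of each `s ∈ ω^N(p)`, a
copy of the previous tree joins the tiles to the scaled puncture of `s`, which the preceding lemma
joins to `0`. Level `n` belongs to `F_{n+1}`, whence the exponent `N * (n + 1)`. -/
lemma reachable_levelTree [Finite E] (hfix : ω.FixesPrototiles)
    (hA : IsFractalGraph ω N G S A) (hF : IsInitialTree ω N G S A F) (n : ℕ) (p : P)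
    {t : Tile P} (ht : t ∈ ω.supertile (N * (n + 1)) p) :
    (placedGraph A (levelTree ω N G S F n p)).Reachable 0 t.2 := by
  induction n generalizing p t with
  | zero => simpa using reachable_levelTree_puncture hfix hA hF 0 p (by simpa using ht)
  | succ n ih =>
    rw [mul_add, mul_one] at ht
    obtain ⟨s, hs, u, hu, rfl⟩ := ω.mem_supertile_add.1 ht
    refine (reachable_levelTree_puncture hfix hA hF (n + 1) p hs).trans ?_
    rw [← zero_add ((ω.scale ^ N) ^ (n + 1) • s.2), pow_mul]
    refine reachable_map A (φ := fun y => y + (ω.scale ^ N) ^ (n + 1) • s.2) (fun l hl => ?_)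
      (ih s.1 hu)
    simp only [add_assoc]
    exact reachable_of_mem A (k := (l.1, l.2 + (ω.scale ^ N) ^ (n + 1) • s.2))
      (Or.inl ⟨s, hs, l, hl, rfl⟩)

/-- The fractal tree connects the punctures of all tiles. -/
lemma reachable_fractalTree [Finite E] (hN : 1 ≤ N) (hfix : ω.FixesPrototiles)
    (hA : IsFractalGraph ω N G S A) (hF : IsInitialTree ω N G S A F) {p : P} {t : Tile P}
    (ht : t ∈ ω.tiling p) :
    (placedGraph A (fractalTree ω N G S F p)).Reachable 0 t.2 := by
  obtain ⟨n, hn⟩ := Set.mem_iUnion.1 ht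
  have hle : n ≤ N * (n + 1) := by nlinarith
  exact (reachable_levelTree hfix hA hF n p (hfix.monotone_supertile p hle hn)).mono
    (placedGraph_mono A (Set.subset_iUnion (fun n => levelTree ω N G S F n p) n))

end Levels

/-! ### Comparison of the fractal and the Euclidean distance. -/

section Distance

variable {P σ I E : Type*} {𝒬 : PrototileSet P} {B : SideStructure 𝒬 σ} {Γ : TreeShape B I E}

lemma le_edgeLength (A : QuasiDualTree Γ) {v : E → ℝ} {m : ℝ} (hm : ∀ e, m ≤ v e)
    {F : Set (E × Plane)} {a b : Plane} (h : (placedGraph A F).Adj a b) :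
    m ≤ edgeLength A v F a b := by
  -- Adjacency provides an edge, so the infimum is not the default value `0` of an empty set.
  refine le_csInf ?_ ?_
  · rcases h.2 with ⟨k, hk, rfl, rfl⟩ | ⟨k, hk, rfl, rfl⟩
    exacts [⟨_, k, hk, rfl, rfl⟩, ⟨_, k, hk, Sym2.eq_swap, rfl⟩]
  · rintro _ ⟨k, -, -, rfl⟩
    exact hm k.1

lemma dist_le_of_adj (A : QuasiDualTree Γ) {C : ℝ}
    (hC : ∀ e, dist (A.pos (Γ.src e)) (A.pos (Γ.tgt e)) ≤ C) {F : Set (E × Plane)} {a b : Plane}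
    (h : (placedGraph A F).Adj a b) : dist a b ≤ C := by
  rcases h.2 with ⟨k, -, rfl, rfl⟩ | ⟨k, -, rfl, rfl⟩
  · simpa using hC k.1
  · simpa [dist_comm] using hC k.1

lemma mul_dist_le_walkLength (A : QuasiDualTree Γ) {v : E → ℝ} {c m C : ℝ} (hc : 0 ≤ c)
    (hcm : c * C ≤ m) (hm : ∀ e, m ≤ v e)
    (hC : ∀ e, dist (A.pos (Γ.src e)) (A.pos (Γ.tgt e)) ≤ C) {F : Set (E × Plane)} {a b : Plane}
    (w : (placedGraph A F).Walk a b) : c * dist a b ≤ walkLength A v F w := by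
  induction w with
  | nil => simp [walkLength]
  | @cons a b d h w ih =>
    have h₁ := le_edgeLength A hm h
    have h₂ := mul_le_mul_of_nonneg_left (dist_le_of_adj A hC h) hc
    have h₃ := mul_le_mul_of_nonneg_left (dist_triangle a b d) hc
    have e : walkLength A v F (SimpleGraph.Walk.cons h w)
        = edgeLength A v F a b + walkLength A v F w := by
      simp [walkLength]
    rw [e]
    linarith

/-- The fractal distance dominates a multiple of the Euclidean distance. -/
lemma exists_mul_dist_le_fractalDist [Finite E] (A : QuasiDualTree Γ) {v : E → ℝ}
    (hv : ∀ e, 0 < v e) :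
    ∃ c > 0, ∀ (F : Set (E × Plane)) (t t' : Tile P), (placedGraph A F).Reachable t.2 t'.2 →
      c * dist t.2 t'.2 ≤ fractalDist A v F t t' := by
  obtain ⟨C, hC⟩ :=
    (Set.finite_range fun e => dist (A.pos (Γ.src e)) (A.pos (Γ.tgt e))).bddAbove
  obtain ⟨M, hM⟩ := (Set.finite_range fun e => (v e)⁻¹).bddAbove
  -- The maxima with `1` keep the constants positive.
  have hM' : ∀ e, (max M 1)⁻¹ ≤ v e := fun e =>
    inv_le_of_inv_le₀ (hv e) ((hM ⟨e, rfl⟩).trans (le_max_left _ _))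
  have hM0 : 0 < max M 1 := lt_max_of_lt_right one_pos
  have hC0 : 0 < max C 1 := lt_max_of_lt_right one_pos
  refine ⟨(max M 1)⁻¹ * (max C 1)⁻¹, by positivity, fun F t t' h => ?_⟩
  classical
  obtain ⟨w⟩ := h
  refine le_csInf ⟨_, w.toPath.1, w.toPath.2, rfl⟩ ?_
  rintro _ ⟨w, -, rfl⟩
  refine mul_dist_le_walkLength A (C := max C 1) (by positivity) ?_ hM'
    (fun e => (hC ⟨e, rfl⟩).trans (le_max_left _ _)) w
  rw [mul_assoc, inv_mul_cancel₀ hC0.ne', mul_one]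

end Distance

/-! ### Summability -/

section Summability

/-- Completing the square: `(2α ln r - 3)² ≥ 0`. The exponent `-3` is chosen below `-2`, as
summation over the plane requires. -/
lemma exp_neg_mul_log_sq_le {α : ℝ} (hα : 0 < α) {r : ℝ} (hr : 0 < r) :
    Real.exp (-α * Real.log r ^ 2) ≤ Real.exp (9 / (4 * α)) * r ^ (-3 : ℝ) := by
  rw [Real.rpow_def_of_pos hr, ← Real.exp_add, Real.exp_le_exp]
  have h : 9 / (4 * α) + Real.log r * -3 - -α * Real.log r ^ 2
      = (2 * α * Real.log r - 3) ^ 2 / (4 * α) := by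
    field_simp
    ring
  have h' : 0 ≤ (2 * α * Real.log r - 3) ^ 2 / (4 * α) := by positivity
  linarith

/-- A non-zero integer has modulus at least `1`, so the rounding error `1/2` is at most half of
`|round y|`. -/
lemma abs_round_le (y : ℝ) : |(round y : ℝ)| ≤ 2 * |y| := by
  by_cases h : round y = 0
  · simp [h]
  · have h1 := abs_sub_round y
    have h2 : (1 : ℝ) ≤ |(round y : ℝ)| := by
      exact_mod_cast Int.one_le_abs h
    have h3 := abs_sub_abs_le_abs_sub (round y : ℝ) y
    rw [abs_sub_comm] at h3
    linarith

/-- Rounding the coordinates of a point of the plane to multiples of `ε`. -/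
def latticePoint (ε : ℝ) (x : Plane) : Fin 2 → ℤ := fun i => round (x i / ε)

lemma norm_latticePoint_le {ε : ℝ} (hε : 0 < ε) (x : Plane) :
    ‖latticePoint ε x‖ ≤ 2 / ε * ‖x‖ := by
  refine (pi_norm_le_iff_of_nonneg (by positivity)).2 fun i => ?_
  rw [Int.norm_eq_abs]
  refine (abs_round_le _).trans ?_
  rw [abs_div, abs_of_pos hε, mul_div_assoc', div_mul_eq_mul_div]
  gcongr
  exact PiLp.norm_apply_le x i

lemma dist_lt_of_latticePoint_eq {ε : ℝ} (hε : 0 < ε) {x y : Plane}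
    (h : latticePoint ε x = latticePoint ε y) : dist x y < 2 * ε := by
  have hi : ∀ i, dist (x i) (y i) ^ 2 ≤ ε ^ 2 := by
    intro i
    have hxy : round (x i / ε) = round (y i / ε) := congrFun h i
    have h1 := abs_sub_round (x i / ε)
    have h2 := abs_sub_round (y i / ε)
    rw [← hxy] at h2
    have h3 : |x i / ε - y i / ε| ≤ 1 := by
      rw [abs_le] at *
      constructor <;> linarith
    rw [← sub_div, abs_div, abs_of_pos hε, div_le_one hε] at h3
    rw [Real.dist_eq]
    gcongr
  rw [EuclideanSpace.dist_eq, Real.sqrt_lt' (by positivity), Fin.sum_univ_two]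
  nlinarith [hi 0, hi 1]

/-- Over a uniformly separated family of non-zero points of the plane, the sum of the inverse cubes
of the norms is finite. -/
lemma summable_norm_rpow_neg_three {ι : Type*} {x : ι → Plane} {δ : ℝ} (hδ : 0 < δ)
    (hx : ∀ i j, i ≠ j → δ ≤ dist (x i) (x j)) (h0 : ∀ i, δ ≤ ‖x i‖) :
    Summable fun i => ‖x i‖ ^ (-3 : ℝ) := by
  -- With mesh `δ / 2`, points that round to the same lattice point are closer than `δ`; so rounding
  -- is injective on the family, and no point of it rounds to `0`.
  have hε : 0 < δ / 2 := by positivity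
  have hinj : Function.Injective fun i => latticePoint (δ / 2) (x i) := by
    intro i j hij
    by_contra hne
    have := dist_lt_of_latticePoint_eq hε hij
    linarith [hx i j hne]
  -- Comparison with the sum of `‖n‖⁻³` over `ℤ²`, which converges because `3 > 2`.
  have hs := (EisensteinSeries.summable_one_div_norm_rpow (k := 3) (by norm_num)).comp_injective
    hinj
  refine (hs.mul_left ((2 / (δ / 2)) ^ (3 : ℝ))).of_nonneg_of_le
    (fun i => by positivity) fun i => ?_
  have hn : latticePoint (δ / 2) (x i) ≠ 0 := by
    intro h
    have hz : latticePoint (δ / 2) (x i) = latticePoint (δ / 2) 0 := by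
      rw [h]
      funext j
      simp [latticePoint]
    have := dist_lt_of_latticePoint_eq hε hz
    rw [dist_zero_right] at this
    linarith [h0 i]
  have hn' : 0 < ‖latticePoint (δ / 2) (x i)‖ := norm_pos_iff.2 hn
  have hxi : 0 < ‖x i‖ := hδ.trans_le (h0 i)
  have hle := norm_latticePoint_le hε (x i)
  have h := Real.rpow_le_rpow_of_nonpos hn' hle (show (-3 : ℝ) ≤ 0 by norm_num)
  rw [Real.mul_rpow (by positivity) (by positivity), Real.rpow_neg (by positivity)] at h
  rwa [← inv_mul_le_iff₀ (by positivity)]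

end Summability

/-- If `∑_t exp(-α a(t)²)` is finite, then `exp(-α D²)` is trace class for the diagonal operator `D`
with eigenvalues `a(t)`. -/
lemma exists_isFunctionOf_exp_isTraceClass {ι : Type*} {a : ι → ℝ} {α : ℝ} (hα : 0 < α)
    (hs : Summable fun t => Real.exp (-α * a t ^ 2)) :
    ∃ K : lp (fun _ : ι => ℂ) 2 →L[ℂ] lp (fun _ : ι => ℂ) 2,
      IsFunctionOf (diagonalOperator a) (fun x => Real.exp (-α * x ^ 2)) K ∧ IsTraceClass K := by
  have hpos : ∀ x : ℝ, 0 ≤ Real.exp (-α * x ^ 2) := fun x => (Real.exp_pos _).le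
  have hle : ∀ x : ℝ, |Real.exp (-α * x ^ 2)| ≤ 1 := fun x => by
    rw [abs_of_nonneg (hpos x), Real.exp_le_one_iff]
    nlinarith [mul_nonneg hα.le (sq_nonneg x)]
  exact ⟨diagonalContraction (fun t => Real.exp (-α * a t ^ 2)) fun t => hle (a t),
    isFunctionOf_diagonal a (f := fun x => Real.exp (-α * x ^ 2)) (by fun_prop) fun t => hle (a t),
    isTraceClass_diagonal _ (fun t => hpos (a t)) hs⟩

/-- The eigenvalues of `exp(-α D_p²)` are summable: the fractal distance to the tile at the origin
dominates a multiple of the Euclidean one, and the punctures are uniformly separated. -/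
lemma summable_exp_neg_log_sq_fractalDist {P σ I E : Type*} [Finite P] [Finite E]
    {𝒬 : PrototileSet P} {B : SideStructure 𝒬 σ} {Γ : TreeShape B I E} {ω : Substitution 𝒬}
    {N : ℕ} {G S A : QuasiDualTree Γ} {F : P → Set (E × Plane)} (hN : 1 ≤ N)
    (hfix : ω.FixesPrototiles) (hA : IsFractalGraph ω N G S A) (hF : IsInitialTree ω N G S A F)
    {v : E → ℝ} (hv : ∀ e, 0 < v e) (p : P) {α : ℝ} (hα : 0 < α) :
    Summable fun t : puncturedTiling ω p => Real.exp (-α *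
      Real.log (fractalDist A v (fractalTree ω N G S F p) t.1 (p, 0)) ^ 2) := by
  obtain ⟨δ, hδ, hsep⟩ := ω.exists_le_dist_puncture hfix
  obtain ⟨c, hc, hd⟩ := exists_mul_dist_le_fractalDist A hv
  have hp : (p, (0 : Plane)) ∈ ω.tiling p :=
    Set.mem_iUnion.2 ⟨0, hfix.puncture_mem_supertile 0 p⟩
  -- The tile `p` has its puncture at the origin, so separation from it bounds the norms below.
  have h0 : ∀ t : puncturedTiling ω p, δ ≤ ‖t.1.2‖ := fun t => by
    simpa using hsep p t.1 t.2.1 _ hp t.2.2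
  have hs := summable_norm_rpow_neg_three (x := fun t : puncturedTiling ω p => t.1.2) hδ
    (fun t t' h => hsep p t.1 t.2.1 t'.1 t'.2.1 (Subtype.coe_injective.ne h)) h0
  refine (hs.mul_left (Real.exp (9 / (4 * α)) * c ^ (-3 : ℝ))).of_nonneg_of_le
    (fun t => (Real.exp_pos _).le) fun t => ?_
  have ht : 0 < ‖t.1.2‖ := hδ.trans_le (h0 t)
  have hle := hd (fractalTree ω N G S F p) t.1 (p, 0)
    (reachable_fractalTree hN hfix hA hF t.2.1).symm
  rw [dist_zero_right] at hle
  have hct : 0 < c * ‖t.1.2‖ := mul_pos hc ht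
  refine (exp_neg_mul_log_sq_le hα (hct.trans_le hle)).trans ?_
  rw [mul_assoc, ← Real.mul_rpow hc.le ht.le]
  gcongr 1
  exact Real.rpow_le_rpow_of_nonpos hct hle (by norm_num)

end FractalTiling

end

theorem mainTheorem4 {P σ I E : Type*} [Fintype P] [DecidableEq P] [Fintype σ] [Fintype I]
    [Fintype E] [DecidableEq E]
    (𝒬 : FractalTiling.PrototileSet P) (ω : FractalTiling.Substitution 𝒬)
    (hprim : ω.IsPrimitive) (hfix : ω.FixesPrototiles)
    (B : FractalTiling.SideStructure 𝒬 σ) (hedge : ∀ p, B.IsSinglyEdgeToEdge (ω.tiling p))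
    (Γ : FractalTiling.TreeShape B I E) (G S A : FractalTiling.QuasiDualTree Γ)
    (N : ℕ) (hN : 1 ≤ N) (hGS : FractalTiling.IsRecurrentPair ω N G S)
    (hA : FractalTiling.IsFractalGraph ω N G S A)
    (hM : (FractalTiling.edgeMatrix ω N G S).IsPrimitive)
    (κ : ℝ) (v : E → ℝ)
    (hv : FractalTiling.IsPerronFrobenius (FractalTiling.edgeMatrix ω N G S) κ v)
    (F : P → Set (E × FractalTiling.Plane))
    (hF : FractalTiling.IsInitialTree ω N G S A F)
    (p : P) (α : ℝ) (hα : 0 < α) :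
    ∃ K : FractalTiling.tilingSpace ω p →L[ℂ] FractalTiling.tilingSpace ω p,
      FractalTiling.IsFunctionOf (FractalTiling.dirac ω N G S A v F p)
        (fun x => Real.exp (-α * x ^ 2)) K ∧
      FractalTiling.IsTraceClass K := by
  exact FractalTiling.exists_isFunctionOf_exp_isTraceClass hα
    (FractalTiling.summable_exp_neg_log_sq_fractalDist hN hfix hA hF hv.1 p hα)
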